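/- All graphs are finite and simple. A VPT representation of a graph $G$ consists of a finite tree $T$ (the host tree) and a family $(P_v)_{v\in V(G)}$ of (nonempty) subpaths of $T$ such that two distinct vertices $v,w$ of $G$ are adjacent if and only if $P_v$ and $P_w$ have at least one vertex in common. A graph is VPT if it has a VPT representation, and it belongs to the class $[h,2,1]$ if it has a VPT representation whose host tree has maximum degree at most $h$. A graph $G$ is a minimal non $[h,2,1]$ graph (a minimal forbidden induced subgraph for $[h,2,1]$) if $G\notin[h,2,1]$ and $G-v\in[h,2,1]$ for every $v\in V(G)$. A graph $H$ is $k$-critical if $\chi(H)=k$, $\chi(H-v)<\chi(H)$ for every vertex $v$ of $H$, and $\chi(H-e)<\chi(H)$ for every edge $e$ of $H$. For a graph $H$, let $G_H$ be the graph whose vertices are: a vertex $s_v$ for each vertex $v$ of $H$; a vertex $k_e$ for each edge $e$ of $H$; and a vertex $\tilde k_v$ for each vertex $v$ of $H$ of degree $1$. The vertices $s_v$ are pairwise nonadjacent; the vertices $k_e$ and $\tilde k_v$ together are pairwise adjacent; $s_v$ is adjacent to $k_e$ if and only if $v$ is an end of $e$; and $s_v$ is adjacent to $\tilde k_w$ if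 and only if $v=w$. Theorem. Let $h\geq 3$ and let $G$ be a VPT graph. Then $G$ is a minimal non $[h,2,1]$ graph if and only if there exists an $(h+1)$-critical graph $H$ such that $G\cong G_H$. -/

import Mathlib

universe u

namespace VPT

/-- `P` is the vertex set of a (nonempty) path of the graph `T`. -/
def IsSubpath {W : Type u} (T : SimpleGraph W) (P : Set W) : Prop :=
  ∃ (a b : W) (p : T.Walk a b), p.IsPath ∧ P = {x | x ∈ p.support}

/-- `(P, T)` is a VPT representation of `G`: `T` is a tree, every `P v` is a subpath of `T`, and
distinct vertices of `G` are adjacent exactly when their subpaths have a vertex in common. -/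
structure IsVPTRep {V W : Type u} (G : SimpleGraph V) (T : SimpleGraph W) (P : V → Set W) :
    Prop where
  isTree : T.IsTree
  isSubpath : ∀ v, IsSubpath T (P v)
  adj_iff : ∀ v w, v ≠ w → (G.Adj v w ↔ (P v ∩ P w).Nonempty)

/-- `G` is a VPT graph: it has a VPT representation in some finite host tree. -/
def IsVPT {V : Type u} (G : SimpleGraph V) : Prop :=
  ∃ (W : Type u) (_ : Finite W) (T : SimpleGraph W) (P : V → Set W), IsVPTRep G T P

/-- The class `[h,2,1]`: `G` has a VPT representation in some finite host tree all of whose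
vertices have degree at most `h`. -/
def InClass (h : ℕ) {V : Type u} (G : SimpleGraph V) : Prop :=
  ∃ (W : Type u) (_ : Finite W) (T : SimpleGraph W) (P : V → Set W),
    IsVPTRep G T P ∧ ∀ x, (T.neighborSet x).ncard ≤ h

/-- `G` is a minimal non `[h,2,1]` graph: `G` is not in `[h,2,1]`, but `G - v` is, for every
vertex `v`. -/
def IsMinimalNon (h : ℕ) {V : Type u} (G : SimpleGraph V) : Prop :=
  ¬ InClass h G ∧ ∀ v : V, InClass h (G.induce {v}ᶜ)

/-- `H` is `k`-critical: its chromatic number is `k`, and deleting any vertex or any edge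
decreases the chromatic number. -/
def IsCritical (k : ℕ) {V : Type u} (H : SimpleGraph V) : Prop :=
  H.chromaticNumber = k ∧
  (∀ v : V, (H.induce {v}ᶜ).chromaticNumber < H.chromaticNumber) ∧
  (∀ e ∈ H.edgeSet, (H.deleteEdges {e}).chromaticNumber < H.chromaticNumber)

/-- The vertices of `G_H`. -/
inductive GHVertex {V : Type u} (H : SimpleGraph V) : Type u
  /-- the stable vertex of a vertex of `H` -/
  | stable (v : V) : GHVertex H
  /-- the clique vertex of an edge of `H` -/
  | edge (e : H.edgeSet) : GHVertex H
  /-- the extra clique vertex of a vertex of degree 1 of `H` -/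
  | extra (v : V) (hv : (H.neighborSet v).ncard = 1) : GHVertex H

/-- Adjacency in `G_H`: stable vertices are pairwise nonadjacent, clique vertices are pairwise
adjacent, the vertex of an edge is adjacent to the stable vertices of its two ends, and the extra
vertex of `v` is adjacent to the stable vertex of `v` only. -/
def GHAdj {V : Type u} (H : SimpleGraph V) : GHVertex H → GHVertex H → Prop
  | .stable _, .stable _ => False
  | .stable v, .edge e => v ∈ e.1
  | .stable v, .extra w _ => v = w
  | .edge e, .stable v => v ∈ e.1
  | .extra w _, .stable v => v = w
  | .edge e, .edge f => e ≠ f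
  | .edge _, .extra _ _ => True
  | .extra _ _, .edge _ => True
  | .extra v _, .extra w _ => v ≠ w

/-- The split graph `G_H` built from `H`. -/
def GH {V : Type u} (H : SimpleGraph V) : SimpleGraph (GHVertex H) where
  Adj := GHAdj H
  symm := ⟨by
    intro a b hab
    cases a <;> cases b <;> simp_all [GHAdj, eq_comm]⟩
  loopless := ⟨by
    intro a ha
    cases a <;> simp [GHAdj] at ha⟩

end VPT

/-! Two operations simplify a representation. Splitting: if no path passes through `q` and two of
its neighbours `y`, `y'`, the edges `qy` and `qy'` can be moved to a new vertex of degree 3 next to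
`q`, which lowers the degree of `q`. So if at every `q` the graph of neighbours joined by a path
through `q` (`passGraph`) is `h`-colourable, repeatedly splitting off equally coloured neighbours
brings all degrees down to `h` (`inClass_of_separates`). Pulling: an edge `qy` such that every path
through `y` uses `q` can be contracted, so the representation may be taken tight
(`IsVPT.exists_isTight`).

If a VPT graph `G` is not in `[h,2,1]`, some `q` of a tight representation has a `passGraph` that is
not `h`-colourable, hence contains an `(h+1)`-critical `H`. Paths through `q` realise the edges of
`H`; tightness supplies, for each vertex of `H`, a path avoiding `q`. Together they induce `G_H` in
`G`, and minimality forces equality.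

Conversely let `H` be `(h+1)`-critical; its degrees are at least 2, so there are no `extra`
vertices. In any representation of `G_H` the clique has a common point `q` by Helly, and colouring
`v` by the branch at `q` that leads to the path of `s_v` is proper on `H`, so `q` has more than `h`
neighbours (`IsCritical.not_inClass_GH`). Once a vertex of `G_H` is deleted, an `h`-colouring of `H`
minus a vertex or an edge makes a star representation splittable (`IsCritical.inClass_GH_induce`).
-/

namespace VPT

/-! ### Connectivity, betweenness and the Helly property in trees -/

section Joined

variable {W W' : Type*} {T : SimpleGraph W} {T' : SimpleGraph W'} {S S' : Set W} {a b c x y q : W}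

/-- `a` and `b` are joined by a walk of `T` inside `S`. -/
def Joined (T : SimpleGraph W) (S : Set W) (a b : W) : Prop :=
  ∃ p : T.Walk a b, ∀ x ∈ p.support, x ∈ S

/-- Any two vertices of `S` are joined inside `S`. -/
def Conn (T : SimpleGraph W) (S : Set W) : Prop :=
  ∀ a ∈ S, ∀ b ∈ S, Joined T S a b

/-- Every walk from `a` to `b` passes through `x`. -/
def Between (T : SimpleGraph W) (a x b : W) : Prop :=
  ∀ p : T.Walk a b, x ∈ p.support

theorem Joined.refl (ha : a ∈ S) : Joined T S a a := ⟨.nil, by simpa using ha⟩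

theorem Joined.symm (h : Joined T S a b) : Joined T S b a := by
  obtain ⟨p, hp⟩ := h
  exact ⟨p.reverse, by simpa using hp⟩

theorem Joined.trans (h : Joined T S a b) (h' : Joined T S b c) : Joined T S a c := by
  obtain ⟨p, hp⟩ := h
  obtain ⟨p', hp'⟩ := h'
  refine ⟨p.append p', fun x hx => ?_⟩
  rcases (SimpleGraph.Walk.mem_support_append_iff _ _).1 hx with hx | hx
  exacts [hp x hx, hp' x hx]

theorem Joined.mono (h : Joined T S a b) (hS : S ⊆ S') : Joined T S' a b := by
  obtain ⟨p, hp⟩ := h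
  exact ⟨p, fun x hx => hS (hp x hx)⟩

theorem Joined.left_mem (h : Joined T S a b) : a ∈ S := by
  obtain ⟨p, hp⟩ := h
  exact hp _ p.start_mem_support

theorem Joined.right_mem (h : Joined T S a b) : b ∈ S := h.symm.left_mem

theorem Joined.of_adj (h : T.Adj a b) (ha : a ∈ S) (hb : b ∈ S) : Joined T S a b :=
  ⟨h.toWalk, by simp [ha, hb]⟩

/-- Transport of joinedness along a map that sends edges to joined pairs. -/
theorem Joined.lift {S' : Set W'} (f : W → W') (hS : ∀ x ∈ S, f x ∈ S')
    (hf : ∀ x ∈ S, ∀ y ∈ S, T.Adj x y → Joined T' S' (f x) (f y)) (h : Joined T S a b) :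
    Joined T' S' (f a) (f b) := by
  obtain ⟨p, hp⟩ := h
  induction p with
  | nil => exact .refl (hS _ (hp _ (by simp)))
  | cons h p ih =>
    refine (hf _ (hp _ (by simp)) _ (hp _ (by simp)) h).trans (ih fun x hx => hp x ?_)
    simp [hx]

theorem Joined.mem_of_closed (h : Joined T S a b) {A : Set W} (ha : a ∈ A)
    (hA : ∀ x ∈ S, ∀ y ∈ S, T.Adj x y → x ∈ A → y ∈ A) : b ∈ A := by
  obtain ⟨p, hp⟩ := h
  induction p with
  | nil => exact ha
  | cons h p ih =>
    exact ih (hA _ (hp _ (by simp)) _ (hp _ (by simp)) h ha) fun x hx => hp x (by simp [hx])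

theorem Conn.union (h : Conn T S) (h' : Conn T S') (hx : x ∈ S) (hx' : x ∈ S') :
    Conn T (S ∪ S') := by
  have key : ∀ a ∈ S ∪ S', Joined T (S ∪ S') a x := by
    rintro a (ha | ha)
    · exact (h a ha x hx).mono Set.subset_union_left
    · exact (h' a ha x hx').mono Set.subset_union_right
  exact fun a ha b hb => (key a ha).trans (key b hb).symm

theorem not_between_iff : ¬ Between T a x b ↔ Joined T {x}ᶜ a b := by
  simp only [Between, Joined, not_forall, Set.mem_compl_iff, Set.mem_singleton_iff]
  refine exists_congr fun p => ⟨fun h y hy e => h (e ▸ hy), fun h hx => h x hx rfl⟩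

theorem Between.mem (h : Between T a x b) (hj : Joined T S a b) : x ∈ S := by
  obtain ⟨p, hp⟩ := hj
  exact hp _ (h p)

theorem Between.symm (h : Between T a x b) : Between T b x a := fun p => by
  simpa using h p.reverse

theorem Joined.exists_path (h : Joined T S a b) :
    ∃ p : T.Walk a b, p.IsPath ∧ ∀ x ∈ p.support, x ∈ S := by
  classical
  obtain ⟨p, hp⟩ := h
  exact ⟨p.bypass, p.bypass_isPath, fun x hx => hp x (p.support_bypass_subset_support hx)⟩

theorem between_of_isPath (hT : T.IsAcyclic) {p : T.Walk a b} (hp : p.IsPath)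
    (hx : x ∈ p.support) : Between T a x b := by
  classical
  intro r
  have := (hT.subsingleton_path a b).elim ⟨p, hp⟩ ⟨r.bypass, r.bypass_isPath⟩
  have h2 : p = r.bypass := congrArg Subtype.val this
  exact r.support_bypass_subset_support (h2 ▸ hx)

theorem Joined.inter (hT : T.IsAcyclic) (h : Joined T S a b) (h' : Joined T S' a b) :
    Joined T (S ∩ S') a b := by
  obtain ⟨p, hp, hS⟩ := h.exists_path
  exact ⟨p, fun x hx => ⟨hS x hx, (between_of_isPath hT hp hx).mem h'⟩⟩

theorem Conn.inter (hT : T.IsAcyclic) (h : Conn T S) (h' : Conn T S') : Conn T (S ∩ S') :=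
  fun a ha b hb => (h a ha.1 b hb.1).inter hT (h' a ha.2 b hb.2)

theorem joined_univ (hT : T.Connected) (a b : W) : Joined T Set.univ a b :=
  ⟨(hT.preconnected a b).some, fun _ _ => trivial⟩

theorem between_of_adj_of_adj (hT : T.IsAcyclic) (h : T.Adj a x) (h' : T.Adj x b) (hab : a ≠ b) :
    Between T a x b := by
  refine between_of_isPath (p := .cons h (.cons h' .nil)) hT ?_ (by simp)
  simp [SimpleGraph.Walk.cons_isPath_iff, h.ne, h'.ne, hab]

/-- If `a` reaches the neighbour `y` of `q` without passing through `q`, then `y` lies between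
`a` and `q`. -/
theorem between_of_joined_compl (hT : T.IsAcyclic) (h : T.Adj y q) (hj : Joined T {q}ᶜ a y) :
    Between T a y q := by
  obtain ⟨p, hp, hS⟩ := hj.exists_path
  exact between_of_isPath hT (hp.concat (fun hq => hS q hq rfl) h) (by simp)

/-- The gate is the first vertex of `S` on a path from `c`: that path followed by a path inside `S`
repeats no vertex, so it is the unique path of the tree. -/
theorem exists_gate (hT : T.IsTree) (hS : Conn T S) (hne : S.Nonempty) (c : W) :
    ∃ x ∈ S, ∀ a ∈ S, Between T a x c := by
  -- Cuts a path ending in `S` at its first vertex in `S`.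
  have first : ∀ {a c : W} (p : T.Walk a c), c ∈ S → p.IsPath →
      ∃ x ∈ S, ∃ r : T.Walk a x, r.IsPath ∧ (∀ z ∈ r.support, z ∈ S → z = x) ∧
        r.support ⊆ p.support := by
    intro a c p
    induction p with
    | nil => exact fun hc _ => ⟨_, hc, .nil, by simp, by simp, by simp⟩
    | @cons u v w h p ih =>
      intro hc hp
      by_cases hu : u ∈ S
      · exact ⟨u, hu, .nil, by simp, by simp, by simp⟩
      · rw [SimpleGraph.Walk.cons_isPath_iff] at hp
        obtain ⟨x, hx, r, hr, hrS, hsub⟩ := ih hc hp.1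
        refine ⟨x, hx, .cons h r, hr.cons fun h => hp.2 (hsub h), ?_, ?_⟩
        · intro z hz hzS
          rcases List.mem_cons.1 hz with rfl | hz
          exacts [absurd hzS hu, hrS z hz hzS]
        · intro z hz
          rcases List.mem_cons.1 hz with rfl | hz
          · simp
          · simp [hsub hz]
  obtain ⟨a₀, ha₀⟩ := hne
  obtain ⟨p, hp, -⟩ := (joined_univ hT.1 c a₀).exists_path
  obtain ⟨x, hx, r, hr, hrS, -⟩ := first p ha₀ hp
  refine ⟨x, hx, fun a ha => Between.symm ?_⟩
  obtain ⟨s, hs, hsS⟩ := (hS x hx a ha).exists_path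
  refine between_of_isPath (p := r.append s) hT.2 (.mk' ?_) (by simp)
  rw [SimpleGraph.Walk.support_append, List.nodup_append]
  refine ⟨hr.support_nodup, hs.support_nodup.tail, ?_⟩
  rintro z hz _ hz' rfl
  have hzx := hrS z hz (hsS z (List.mem_of_mem_tail hz'))
  subst hzx
  have := hs.support_nodup
  rw [← SimpleGraph.Walk.cons_tail_support] at this
  exact (List.nodup_cons.1 this).1 hz'

/-- The gate of `C` towards a point of `A ∩ B` lies in `A` and in `B`, since each of them joins that
point to a point of `C`. -/
theorem exists_mem_inter_three (hT : T.IsTree) {A B C : Set W} (hA : Conn T A) (hB : Conn T B)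
    (hC : Conn T C) (hAB : (A ∩ B).Nonempty) (hAC : (A ∩ C).Nonempty) (hBC : (B ∩ C).Nonempty) :
    (A ∩ B ∩ C).Nonempty := by
  obtain ⟨c, hc⟩ := hAB
  obtain ⟨b, hb⟩ := hAC
  obtain ⟨a, ha⟩ := hBC
  obtain ⟨x, hx, hgate⟩ := exists_gate hT hC ⟨b, hb.2⟩ c
  exact ⟨x, ⟨(hgate b hb.2).mem (hA b hb.1 c hc.1), (hgate a ha.2).mem (hB a ha.1 c hc.2)⟩, hx⟩

/-- The Helly property of subtrees of a tree. -/
theorem helly {ι : Type*} (hT : T.IsTree) (s : Finset ι) (A : ι → Set W)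
    (hA : ∀ i ∈ s, Conn T (A i)) (hAA : ∀ i ∈ s, ∀ j ∈ s, (A i ∩ A j).Nonempty) :
    ∃ x, ∀ i ∈ s, x ∈ A i := by
  classical
  induction s using Finset.induction_on generalizing A with
  | empty => exact ⟨hT.1.nonempty.some, by simp⟩
  | @insert k s hk ih =>
    rcases s.eq_empty_or_nonempty with rfl | ⟨j₀, hj₀⟩
    · obtain ⟨x, hx⟩ := hAA k (by simp) k (by simp)
      exact ⟨x, by simpa using hx⟩
    -- Induction applies to the traces on `A k`, which meet pairwise by the case of three sets.
    obtain ⟨x, hx⟩ := ih (fun i => A i ∩ A k)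
      (fun i hi => (hA i (by simp [hi])).inter hT.2 (hA k (by simp))) (fun i hi j hj => by
        obtain ⟨x, hx⟩ := exists_mem_inter_three hT (hA i (by simp [hi])) (hA j (by simp [hj]))
          (hA k (by simp)) (hAA _ (by simp [hi]) _ (by simp [hj]))
          (hAA _ (by simp [hi]) _ (by simp)) (hAA _ (by simp [hj]) _ (by simp))
        exact ⟨x, ⟨hx.1.1, hx.2⟩, hx.1.2, hx.2⟩)
    refine ⟨x, fun i hi => ?_⟩
    rcases Finset.mem_insert.1 hi with rfl | hi
    exacts [(hx j₀ hj₀).2, (hx i hi).1]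

theorem between_or_between_of_isPath (hT : T.IsAcyclic) {p : T.Walk a b} (hp : p.IsPath)
    (hx : x ∈ p.support) (hy : y ∈ p.support) : Between T a x y ∨ Between T a y x := by
  classical
  by_cases hxy : x ∈ (p.takeUntil y hy).support
  · exact .inl (between_of_isPath hT (hp.takeUntil hy) hxy)
  · have hx' : x ∈ (p.dropUntil y hy).support := by
      rw [← p.take_spec hy, SimpleGraph.Walk.mem_support_append_iff] at hx
      exact hx.resolve_left hxy
    rw [← p.take_spec hy, ← (p.dropUntil y hy).take_spec hx', SimpleGraph.Walk.append_assoc] at hp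
    exact .inr (between_of_isPath hT hp.of_append_left (by simp))

/-- Of three vertices of a path in a tree, one lies between the other two. -/
theorem between_of_mem_path (hT : T.IsAcyclic) {p : T.Walk a b} (hp : p.IsPath)
    (hx : x ∈ p.support) (hy : y ∈ p.support) (hq : q ∈ p.support) :
    Between T x q y ∨ Between T q x y ∨ Between T q y x := by
  induction p with
  | nil =>
    simp only [SimpleGraph.Walk.support_nil, List.mem_singleton] at hx hy hq
    subst hx hy hq
    exact .inl fun p => p.start_mem_support
  | @cons u v w h p ih =>
    rcases List.mem_cons.1 hx with rfl | hx'
    · rcases between_or_between_of_isPath hT hp hy hq with h | h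
      exacts [.inr (.inr h.symm), .inl h]
    rcases List.mem_cons.1 hy with rfl | hy'
    · rcases between_or_between_of_isPath hT hp hx hq with h | h
      exacts [.inr (.inl h.symm), .inl h.symm]
    rcases List.mem_cons.1 hq with rfl | hq'
    · exact .inr (between_or_between_of_isPath hT hp hx hy)
    exact ih hp.of_cons hx' hy' hq'

end Joined

/-! ### Subpaths described by betweenness -/

section Subpath

variable {W : Type u} {T : SimpleGraph W} {P : Set W}

/-- With its converse `IsSubpath.exists_between`, this replaces explicit paths by joinedness and
separation, which are easy to carry over to a modified tree. -/
theorem isSubpath_of_between {a b : W} (hj : Joined T P a b) (h : ∀ x ∈ P, Between T a x b) :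
    IsSubpath T P := by
  obtain ⟨p, hp, hS⟩ := hj.exists_path
  exact ⟨a, b, p, hp, Set.ext fun x => ⟨fun hx => h x hx p, fun hx => hS x hx⟩⟩

theorem IsSubpath.exists_between (hT : T.IsAcyclic) (h : IsSubpath T P) :
    ∃ a b, Joined T P a b ∧ ∀ x ∈ P, Between T a x b := by
  obtain ⟨a, b, p, hp, rfl⟩ := h
  exact ⟨a, b, ⟨p, fun x hx => hx⟩, fun x hx => between_of_isPath hT hp hx⟩

theorem IsSubpath.nonempty (h : IsSubpath T P) : P.Nonempty := by
  obtain ⟨a, b, p, hp, rfl⟩ := h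
  exact ⟨a, p.start_mem_support⟩

theorem IsSubpath.conn (h : IsSubpath T P) : Conn T P := by
  classical
  obtain ⟨a, b, p, hp, rfl⟩ := h
  have key : ∀ x ∈ p.support, Joined T {x | x ∈ p.support} a x := fun x hx =>
    ⟨p.takeUntil x hx, fun y hy => p.support_takeUntil_subset_support hx hy⟩
  exact fun x hx y hy => (key x hx).symm.trans (key y hy)

theorem IsSubpath.between (hT : T.IsAcyclic) (h : IsSubpath T P) {x y q : W} (hx : x ∈ P)
    (hy : y ∈ P) (hq : q ∈ P) : Between T x q y ∨ Between T q x y ∨ Between T q y x := by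
  obtain ⟨a, b, p, hp, rfl⟩ := h
  exact between_of_mem_path hT hp hx hy hq

/-- A vertex has at most two neighbours on a subpath. -/
theorem IsSubpath.eq_or_eq (hT : T.IsAcyclic) (h : IsSubpath T P) {q x y z : W}
    (hx : x ∈ P) (hy : y ∈ P) (hz : z ∈ P) (hqx : T.Adj q x) (hqy : T.Adj q y)
    (hqz : T.Adj q z) (hxy : x ≠ y) : z = x ∨ z = y := by
  by_contra! hne
  have key : ∀ {x y z : W}, T.Adj q x → T.Adj q y → T.Adj q z → z ≠ x → z ≠ y →
      ¬ Between T x z y := fun hx hy hz h1 h2 h => by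
    have := h (.cons hx.symm (.cons hy .nil))
    simp [h1, h2, hz.ne'] at this
  rcases h.between hT hx hy hz with h | h | h
  · exact key hqx hqy hqz hne.1 hne.2 h
  · exact key hqz hqy hqx hne.1.symm hxy h
  · exact key hqz hqx hqy hne.2.symm hxy.symm h

end Subpath

theorem isTree_of_edges_le {W : Type*} [Finite W] {T : SimpleGraph W} (hc : T.Connected)
    (h : T.edgeSet.ncard + 1 ≤ Nat.card W) : T.IsTree :=
  SimpleGraph.isTree_iff_connected_and_card.2
    ⟨hc, le_antisymm h hc.card_vert_le_card_edgeSet_add_one⟩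

/-! ### Splitting a host vertex to lower its degree -/

section Split

variable {W : Type u} {T : SimpleGraph W} {P Q : Set W} {q y y' : W}

theorem joined_or_joined_of_adj (hT : T.Connected) {z : W} (h : T.Adj q z) (x : W) :
    Joined T {z}ᶜ q x ∨ Joined T {q}ᶜ z x := by
  refine (joined_univ hT q x).mem_of_closed (A := {x | Joined T {z}ᶜ q x ∨ Joined T {q}ᶜ z x})
    (.inl (.refl h.ne)) ?_
  rintro x - x' - hxx' (hx | hx)
  · by_cases hz : x' = z
    · subst hz; exact .inr (.refl h.ne')
    · exact .inl (hx.trans (.of_adj hxx' hx.right_mem hz))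
  · by_cases hz : x' = q
    · subst hz; exact .inl (.refl h.ne)
    · exact .inr (hx.trans (.of_adj hxx' hx.right_mem hz))

/-- Insert a new vertex `none` next to `q` and move the edges from `q` to `y` and `y'` onto it. -/
def splitGraph (T : SimpleGraph W) (q y y' : W) : SimpleGraph (Option W) where
  Adj
    | some a, some b => T.Adj a b ∧ ¬ (a = q ∧ (b = y ∨ b = y')) ∧ ¬ (b = q ∧ (a = y ∨ a = y'))
    | some a, none => a = q ∨ a = y ∨ a = y'
    | none, some a => a = q ∨ a = y ∨ a = y'
    | none, none => False
  symm := ⟨by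
    rintro (_ | a) (_ | b) h
    · exact h
    · exact h
    · exact h
    · exact ⟨h.1.symm, h.2.2, h.2.1⟩⟩
  loopless := ⟨by
    rintro (_ | a) h
    · exact h
    · exact h.1.ne rfl⟩

/-- The image of a subpath in `splitGraph`. -/
def splitSet (q y y' : W) (P : Set W) : Set (Option W) :=
  {z | match z with
    | some x => x ∈ P
    | none => q ∈ P ∧ (y ∈ P ∨ y' ∈ P)}

@[simp] theorem some_mem_splitSet {x : W} : some x ∈ splitSet q y y' P ↔ x ∈ P := Iff.rfl

@[simp] theorem none_mem_splitSet :
    none ∈ splitSet q y y' P ↔ q ∈ P ∧ (y ∈ P ∨ y' ∈ P) := Iff.rfl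

@[simp] theorem splitGraph_some_none {a : W} : (splitGraph T q y y').Adj (some a) none ↔
    a = q ∨ a = y ∨ a = y' := Iff.rfl

@[simp] theorem splitGraph_none_some {a : W} : (splitGraph T q y y').Adj none (some a) ↔
    a = q ∨ a = y ∨ a = y' := Iff.rfl

@[simp] theorem splitGraph_none_none : ¬ (splitGraph T q y y').Adj none none := id

theorem splitSet_inter_nonempty :
    (splitSet q y y' P ∩ splitSet q y y' Q).Nonempty ↔ (P ∩ Q).Nonempty := by
  constructor
  · rintro ⟨_ | x, hx, hx'⟩
    exacts [⟨q, hx.1, hx'.1⟩, ⟨x, hx, hx'⟩]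
  · rintro ⟨x, hx, hx'⟩
    exact ⟨some x, hx, hx'⟩

theorem Joined.split {S : Set W} {a b : W} (h : Joined T S a b) :
    Joined (splitGraph T q y y') (splitSet q y y' S) (some a) (some b) := by
  refine h.lift some (fun x hx => hx) fun a ha b hb hab => ?_
  have ha' : a ∈ S := ha
  have hb' : b ∈ S := hb
  by_cases h1 : a = q ∧ (b = y ∨ b = y')
  · have hn : none ∈ splitSet q y y' S := by
      obtain ⟨rfl, rfl | rfl⟩ := h1 <;> simp [ha', hb']
    refine (Joined.of_adj (b := none) ?_ ha hn).trans (.of_adj ?_ hn hb) <;> simp [h1]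
  by_cases h2 : b = q ∧ (a = y ∨ a = y')
  · have hn : none ∈ splitSet q y y' S := by
      obtain ⟨rfl, rfl | rfl⟩ := h2 <;> simp [ha', hb']
    refine (Joined.of_adj (b := none) ?_ ha hn).trans (.of_adj ?_ hn hb) <;> simp [h2]
  exact .of_adj ⟨hab, h1, h2⟩ ha hb

theorem Joined.of_split (hy : T.Adj q y) (hy' : T.Adj q y') {x a b : W} (hx : x ≠ q)
    (h : Joined (splitGraph T q y y') {some x}ᶜ (some a) (some b)) : Joined T {x}ᶜ a b := by
  refine h.lift (S' := {x}ᶜ) (fun z => z.getD q) ?_ ?_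
  · rintro (_ | z) hz
    · exact hx.symm
    · simpa using hz
  · rintro (_ | u) hu (_ | v) hv huv
    · exact .refl hx.symm
    · obtain rfl | rfl | rfl := huv
      · exact .refl hx.symm
      · exact .of_adj hy hx.symm (by simpa using hv)
      · exact .of_adj hy' hx.symm (by simpa using hv)
    · obtain rfl | rfl | rfl := huv
      · exact .refl hx.symm
      · exact .of_adj hy.symm (by simpa using hu) hx.symm
      · exact .of_adj hy'.symm (by simpa using hu) hx.symm
    · exact .of_adj huv.1 (by simpa using hu) (by simpa using hv)

/-- Without `q`, the new vertex can only link the branches of `y` and `y'`, so a walk that leaves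
the branch of `a` does so through `y` or `y'`. -/
theorem Joined.of_split_center {a b : W}
    (h : Joined (splitGraph T q y y') {some q}ᶜ (some a) (some b)) :
    Joined T {q}ᶜ a b ∨ Joined T {q}ᶜ a y ∨ Joined T {q}ᶜ a y' := by
  by_contra! hcon
  have ha : a ∈ ({q}ᶜ : Set W) := by simpa using h.left_mem
  have := h.mem_of_closed (A := some '' {x | Joined T {q}ᶜ a x}) ⟨a, .refl ha, rfl⟩ (by
    rintro _ - (_ | v) hv hadj ⟨u, hu, rfl⟩
    · rcases hadj with rfl | rfl | rfl
      exacts [absurd rfl hu.right_mem, absurd hu hcon.2.1, absurd hu hcon.2.2]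
    · exact ⟨v, hu.trans (.of_adj hadj.1 hu.right_mem (by simpa using hv)), rfl⟩)
  obtain ⟨x, hx, e⟩ := this
  exact hcon.1 (Option.some.inj e ▸ hx)

/-- The edge `qz` is gone after the split, so a walk avoiding `none` cannot change sides of it. -/
theorem Joined.of_split_none (hT : T.IsTree) {z a b : W} (hz : z = y ∨ z = y') (hqz : T.Adj q z)
    (h : Joined (splitGraph T q y y') {none}ᶜ (some a) (some b)) :
    Joined T {z}ᶜ a b ∨ Joined T {q}ᶜ a b := by
  have side : ∀ {a b : W}, Joined (splitGraph T q y y') {none}ᶜ (some a) (some b) →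
      Joined T {z}ᶜ q a → Joined T {z}ᶜ q b := fun {a b} h ha => by
    have := h.mem_of_closed (A := some '' {x | Joined T {z}ᶜ q x}) ⟨a, ha, rfl⟩ (by
      rintro _ - (_ | v) hv hadj ⟨u, hu, rfl⟩
      · simp at hv
      refine ⟨v, hu.trans (.of_adj hadj.1 hu.right_mem fun hvz => ?_), rfl⟩
      obtain rfl : v = z := hvz
      -- The only edge of `T` from the side of `q` to `z` is `qz`, which the split removed.
      refine not_between_iff.2 hu (between_of_adj_of_adj hT.2 hqz hadj.1.symm fun e => ?_)
      exact hadj.2.1 ⟨e.symm, hz⟩)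
    obtain ⟨x, hx, e⟩ := this
    exact Option.some.inj e ▸ hx
  rcases joined_or_joined_of_adj hT.1 hqz a with ha | ha
  · exact .inl (ha.symm.trans (side h ha))
  · rcases joined_or_joined_of_adj hT.1 hqz b with hb | hb
    · exact .inl ((side h.symm hb).symm.trans hb)
    · exact .inr (ha.symm.trans hb)

/-- `hqP` is essential: a path through `y`, `q`, `y'` would turn into a claw centred at `none`. -/
theorem IsSubpath.split (hT : T.IsTree) (hy : T.Adj q y) (hy' : T.Adj q y')
    (hP : IsSubpath T P) (hqP : ¬ (q ∈ P ∧ y ∈ P ∧ y' ∈ P)) :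
    IsSubpath (splitGraph T q y y') (splitSet q y y' P) := by
  obtain ⟨a, b, hab, hbt⟩ := hP.exists_between hT.2
  refine isSubpath_of_between hab.split ?_
  rintro (_ | x) hx
  · by_contra hcon
    rw [not_between_iff] at hcon
    obtain ⟨z, hz, hqz, hzP⟩ : ∃ z, (z = y ∨ z = y') ∧ T.Adj q z ∧ z ∈ P := by
      rcases hx.2 with h | h
      exacts [⟨y, .inl rfl, hy, h⟩, ⟨y', .inr rfl, hy', h⟩]
    rcases hcon.of_split_none hT hz hqz with h | h
    exacts [not_between_iff.2 h (hbt z hzP), not_between_iff.2 h (hbt q hx.1)]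
  · by_contra hcon
    rw [not_between_iff] at hcon
    have hx : x ∈ P := hx
    by_cases hxq : x = q
    · subst hxq
      have hn : ¬ Joined T {x}ᶜ a b := fun h => not_between_iff.2 h (hbt x hx)
      have ha := hab.left_mem
      have hb := hab.right_mem
      have mem : ∀ {a z}, a ∈ P → T.Adj x z → Joined T {x}ᶜ a z → z ∈ P := fun ha hz hj =>
        (between_of_joined_compl hT.2 hz.symm hj).mem (hP.conn _ ha _ hx)
      rcases hcon.of_split_center with h | h | h
      · exact hn h
      · rcases hcon.symm.of_split_center with h' | h' | h'
        · exact hn h'.symm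
        · exact hn (h.trans h'.symm)
        -- The ends lie in the branches of `y` and `y'`, so the path runs through `y`, `q`, `y'`.
        · exact hqP ⟨hx, mem ha hy h, mem hb hy' h'⟩
      · rcases hcon.symm.of_split_center with h' | h' | h'
        · exact hn h'.symm
        · exact hqP ⟨hx, mem hb hy h', mem ha hy' h⟩
        · exact hn (h.trans h'.symm)
    · exact not_between_iff.2 (hcon.of_split hy hy' hxq) (hbt x hx)

/-- Connectedness survives, and the one new vertex is balanced by the one new edge between `none`
and `q`; every other edge is the image of an old one. -/
theorem isTree_splitGraph [Finite W] (hT : T.IsTree) (hy : T.Adj q y) (hy' : T.Adj q y') :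
    (splitGraph T q y y').IsTree := by
  classical
  refine isTree_of_edges_le ?_ ?_
  · refine SimpleGraph.connected_iff_exists_forall_reachable _ |>.2 ⟨some q, ?_⟩
    rintro (_ | x)
    · exact SimpleGraph.Adj.reachable (by simp)
    · obtain ⟨p, -⟩ := (joined_univ hT.1 q x).split (q := q) (y := y) (y' := y')
      exact p.reachable
  · let g : Sym2 W → Sym2 (Option W) := fun e =>
      if e = s(q, y) then s(none, some y) else if e = s(q, y') then s(none, some y')
      else e.map some
    have hgy : g s(q, y) = s(none, some y) := by simp [g]
    have hgy' : g s(q, y') = s(none, some y') := by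
      by_cases h : y' = y
      · subst h; exact hgy
      · have h1 : s(q, y') ≠ s(q, y) := fun e => h (Sym2.congr_right.1 e)
        simp only [g, if_neg h1, if_true]
    have key : ∀ z, z = q ∨ z = y ∨ z = y' →
        s(none, some z) ∈ insert s(none, some q) (g '' T.edgeSet) := by
      rintro z (rfl | rfl | rfl)
      exacts [.inl rfl, .inr ⟨_, hy, hgy⟩, .inr ⟨_, hy', hgy'⟩]
    have hsub : (splitGraph T q y y').edgeSet ⊆ insert s(none, some q) (g '' T.edgeSet) := by
      rintro ⟨_ | a, _ | b⟩ h
      · exact absurd (show (splitGraph T q y y').Adj none none from h) splitGraph_none_none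
      · exact key b h
      · rw [show Quot.mk _ (some a, none) = s(none, some a) from Sym2.eq_swap]
        exact key a h
      · have h : T.Adj a b ∧ ¬ (a = q ∧ (b = y ∨ b = y')) ∧ ¬ (b = q ∧ (a = y ∨ a = y')) := h
        refine .inr ⟨s(a, b), h.1, ?_⟩
        have h1 : s(a, b) ≠ s(q, y) := by rw [Ne, Sym2.eq_iff]; tauto
        have h2 : s(a, b) ≠ s(q, y') := by rw [Ne, Sym2.eq_iff]; tauto
        simp only [g, if_neg h1, if_neg h2]
        rfl
    have h1 := Set.ncard_le_ncard hsub (Set.toFinite _)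
    have h2 := Set.ncard_insert_le s(none, some q) (g '' T.edgeSet)
    have h3 := Set.ncard_image_le (f := g) (Set.toFinite T.edgeSet)
    have h4 := (SimpleGraph.isTree_iff_connected_and_card.1 hT).2
    have h5 : T.edgeSet.ncard = Nat.card T.edgeSet := rfl
    have h6 : Nat.card (Option W) = Nat.card W + 1 := Finite.card_option
    omega

theorem ncard_neighborSet_splitGraph_none :
    ((splitGraph T q y y').neighborSet none).ncard ≤ 3 := by
  classical
  have hsub : (splitGraph T q y y').neighborSet none ⊆
      (({some q, some y, some y'} : Finset (Option W)) : Set (Option W)) := by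
    rintro (_ | z) hz
    · exact absurd (show (splitGraph T q y y').Adj none none from hz) splitGraph_none_none
    · have hz : z = q ∨ z = y ∨ z = y' := hz
      simpa using hz
  exact (Set.ncard_le_ncard hsub (Set.toFinite _)).trans
    ((Set.ncard_coe_finset _).le.trans Finset.card_le_three)

theorem ncard_neighborSet_splitGraph_some [Finite W] {x : W} (hy : T.Adj q y)
    (hy' : T.Adj q y') (hx : x ≠ q) :
    ((splitGraph T q y y').neighborSet (some x)).ncard ≤ (T.neighborSet x).ncard := by
  classical
  let g : W → Option W := fun z => if z = q ∧ (x = y ∨ x = y') then none else some z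
  have hsub : (splitGraph T q y y').neighborSet (some x) ⊆ g '' T.neighborSet x := by
    rintro (_ | z) hz
    · have hz : x = q ∨ x = y ∨ x = y' := hz
      refine ⟨q, ?_, by simp [g, hz.resolve_left hx]⟩
      rcases hz.resolve_left hx with rfl | rfl
      exacts [hy.symm, hy'.symm]
    · exact ⟨z, hz.1, by simp only [g]; rw [if_neg hz.2.2]⟩
  exact (Set.ncard_le_ncard hsub (Set.toFinite _)).trans (Set.ncard_image_le (Set.toFinite _))

theorem ncard_neighborSet_splitGraph_center [Finite W] (hy : T.Adj q y)
    (hy' : T.Adj q y') (hyy' : y ≠ y') :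
    ((splitGraph T q y y').neighborSet (some q)).ncard < (T.neighborSet q).ncard := by
  classical
  let g : W → Option W := fun z => if z = y then none else some z
  have hsub : (splitGraph T q y y').neighborSet (some q) ⊆ g '' (T.neighborSet q \ {y'}) := by
    rintro (_ | z) hz
    · exact ⟨y, ⟨hy, hyy'⟩, by simp [g]⟩
    · have h2 := hz.2.1
      simp only [true_and, not_or] at h2
      exact ⟨z, ⟨hz.1, h2.2⟩, by simp [g, h2.1]⟩
  have h1 := (Set.ncard_le_ncard hsub (Set.toFinite _)).trans
    (Set.ncard_image_le (Set.toFinite _))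
  exact h1.trans_lt (Set.ncard_sdiff_singleton_lt_of_mem hy' (Set.toFinite _))

/-- The colouring `c` of the neighbours of `q` separates any two of them on a common path
through `q`. -/
def Separates {V C : Type*} (T : SimpleGraph W) (P : V → Set W) (q : W) (c : W → C) : Prop :=
  ∀ v, q ∈ P v → ∀ y ∈ P v, ∀ y' ∈ P v, T.Adj q y → T.Adj q y' → c y = c y' → y = y'

/-- The new vertex takes the common colour of the two neighbours it replaces. -/
theorem Separates.split_center {V C : Type*} {P : V → Set W} {c : W → C}
    (hc : Separates T P q c) (hy : T.Adj q y) (hy' : T.Adj q y') (hcy : c y = c y') :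
    Separates (splitGraph T q y y') (fun v => splitSet q y y' (P v)) (some q)
      (fun z => z.elim (c y) c) := by
  have key : ∀ v b, q ∈ P v → (y ∈ P v ∨ y' ∈ P v) → b ∈ P v → T.Adj q b →
      ¬ (b = y ∨ b = y') → c y = c b → False := by
    rintro v b hq (h | h) hb hqb hne hcb
    · exact hne (.inl (hc v hq b hb y h hqb hy hcb.symm))
    · exact hne (.inr (hc v hq b hb y' h hqb hy' (hcb.symm.trans hcy)))
  rintro v hq (_ | a) ha (_ | b) hb hqa hqb hab
  · rfl
  · exact (key v b hq ha.2 hb hqb.1 (fun h => hqb.2.1 ⟨rfl, h⟩) hab).elim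
  · exact (key v a hq hb.2 ha hqa.1 (fun h => hqa.2.1 ⟨rfl, h⟩) hab.symm).elim
  · exact congrArg some (hc v hq a ha b hb hqa.1 hqb.1 hab)

/-- Seen from `y` or `y'`, the new vertex stands in for `q`, so it takes the colour of `q`. -/
theorem Separates.split_some {V C : Type*} {P : V → Set W} {c : W → C} {x : W} (hx : x ≠ q)
    (hc : Separates T P x c) (hy : T.Adj q y) (hy' : T.Adj q y') :
    Separates (splitGraph T q y y') (fun v => splitSet q y y' (P v)) (some x)
      (fun z => c (z.getD q)) := by
  have adj : x = y ∨ x = y' → T.Adj x q := by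
    rintro (rfl | rfl)
    exacts [hy.symm, hy'.symm]
  have key : ∀ v b, x ∈ P v → q ∈ P v → (x = y ∨ x = y') → b ∈ P v →
      (splitGraph T q y y').Adj (some x) (some b) → c q = c b → False := by
    intro v b hxv hq h hb hxb hcb
    have := hc v hxv q hq b hb (adj h) hxb.1 hcb
    exact hxb.2.2 ⟨this.symm, h⟩
  rintro v hq (_ | a) ha (_ | b) hb hqa hqb hab
  · rfl
  · exact (key v b hq ha.1 (hqa.resolve_left hx) hb hqb hab).elim
  · exact (key v a hq hb.1 (hqb.resolve_left hx) ha hqa hab.symm).elim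
  · exact congrArg some (hc v hq a ha b hb hqa.1 hqb.1 hab)

/-- Induction on the total excess of the degrees over `h`. -/
theorem inClass_of_separates_aux {V : Type u} {G : SimpleGraph V} {h : ℕ} (hh : 3 ≤ h) (n : ℕ) :
    ∀ {W : Type u} [Fintype W] {T : SimpleGraph W} {P : V → Set W}, IsVPTRep G T P →
      (∀ q, h < (T.neighborSet q).ncard → ∃ c : W → Fin h, Separates T P q c) →
      ∑ q, ((T.neighborSet q).ncard - h) = n → InClass h G := by
  induction n using Nat.strong_induction_on with
  | _ n ih =>
  intro W _ T P hrep hc hn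
  by_cases hdeg : ∀ q, (T.neighborSet q).ncard ≤ h
  · exact ⟨W, inferInstance, T, P, hrep, hdeg⟩
  push Not at hdeg
  obtain ⟨q, hq⟩ := hdeg
  obtain ⟨c, hcq⟩ := hc q hq
  -- Pigeonhole: more than `h` neighbours, `h` colours.
  obtain ⟨y, hy, y', hy', hyy', hcy⟩ := Set.exists_ne_map_eq_of_ncard_lt_of_maps_to
    (s := T.neighborSet q) (t := (Set.univ : Set (Fin h))) (f := c)
    (by simpa using hq) (fun _ _ => Set.mem_univ _)
  have hy : T.Adj q y := hy
  have hy' : T.Adj q y' := hy'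
  have hle := fun x (hx : x ≠ q) => ncard_neighborSet_splitGraph_some (y' := y') hy hy' hx
  have hlt := ncard_neighborSet_splitGraph_center hy hy' hyy'
  have hnone := ncard_neighborSet_splitGraph_none (T := T) (q := q) (y := y) (y' := y')
  refine ih _ ?_ (T := splitGraph T q y y') (P := fun v => splitSet q y y' (P v)) ⟨?_, ?_, ?_⟩ ?_ rfl
  -- The new vertex adds no excess because its degree is at most `3 ≤ h`.
  · rw [Fintype.sum_option, ← hn, Nat.sub_eq_zero_of_le (hnone.trans hh), zero_add]
    refine Finset.sum_lt_sum (fun x _ => ?_) ⟨q, Finset.mem_univ _, by omega⟩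
    by_cases hx : x = q
    · subst hx; omega
    · have := hle x hx; omega
  · exact isTree_splitGraph hrep.isTree hy hy'
  · intro v
    exact (hrep.isSubpath v).split hrep.isTree hy hy' fun hv =>
      hyy' (hcq v hv.1 y hv.2.1 y' hv.2.2 hy hy' hcy)
  · intro v w hvw
    rw [hrep.adj_iff v w hvw, splitSet_inter_nonempty]
  · rintro (_ | x) hx
    · omega
    by_cases hxq : x = q
    · subst hxq
      exact ⟨_, hcq.split_center hy hy' hcy⟩
    · obtain ⟨c', hc'⟩ := hc x (hx.trans_le (hle x hxq))
      exact ⟨_, hc'.split_some hxq hy hy'⟩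

theorem inClass_of_separates {V : Type u} {G : SimpleGraph V} {h : ℕ} (hh : 3 ≤ h) [Finite W]
    {P : V → Set W} (hrep : IsVPTRep G T P)
    (hc : ∀ q, h < (T.neighborSet q).ncard → ∃ c : W → Fin h, Separates T P q c) :
    InClass h G := by
  have := Fintype.ofFinite W
  exact inClass_of_separates_aux hh _ hrep hc rfl

end Split

/-! ### Contracting edges to reach a tight representation -/

section Pull

variable {W : Type u} {T : SimpleGraph W} {P Q : Set W} {q y : W}

/-- Reattach to `q` all the neighbours of its neighbour `y`, which becomes a leaf. -/
def pullGraph (T : SimpleGraph W) (q y : W) : SimpleGraph W :=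
  SimpleGraph.fromRel fun a b =>
    (T.Adj a b ∧ a ≠ y ∧ b ≠ y) ∨ (a = q ∧ T.Adj y b) ∨ (a = q ∧ b = y)

open Classical in
/-- The map sending `y` to `q` and fixing everything else. -/
noncomputable def collapse (q y z : W) : W := if z = y then q else z

theorem collapse_self : collapse q y y = q := if_pos rfl

theorem collapse_of_ne {z : W} (h : z ≠ y) : collapse q y z = z := if_neg h

theorem collapse_mem {z : W} (hqy : q ≠ y) (hq : y ∈ P → q ∈ P) (hz : z ∈ P) :
    collapse q y z ∈ P \ {y} := by
  by_cases h : z = y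
  · subst h; rw [collapse_self]; exact ⟨hq hz, hqy⟩
  · rw [collapse_of_ne h]; exact ⟨hz, h⟩

theorem pullGraph_adj_collapse {a b : W} (hab : T.Adj a b)
    (hne : collapse q y a ≠ collapse q y b) :
    (pullGraph T q y).Adj (collapse q y a) (collapse q y b) := by
  refine (SimpleGraph.fromRel_adj _ _ _).2 ⟨hne, ?_⟩
  by_cases ha : a = y
  · subst ha
    rw [collapse_self, collapse_of_ne hab.ne']
    exact .inl (.inr (.inl ⟨rfl, hab⟩))
  · by_cases hb : b = y
    · subst hb
      rw [collapse_self, collapse_of_ne ha]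
      exact .inr (.inr (.inl ⟨rfl, hab.symm⟩))
    · rw [collapse_of_ne ha, collapse_of_ne hb]
      exact .inl (.inl ⟨hab, ha, hb⟩)

theorem Joined.pull {a b : W} (hqy : q ≠ y) (hq : y ∈ P → q ∈ P) (h : Joined T P a b) :
    Joined (pullGraph T q y) (P \ {y}) (collapse q y a) (collapse q y b) := by
  refine h.lift _ (fun x hx => collapse_mem hqy hq hx) fun x hx z hz hxz => ?_
  by_cases hne : collapse q y x = collapse q y z
  · rw [← hne]; exact .refl (collapse_mem hqy hq hx)
  · exact .of_adj (pullGraph_adj_collapse hxz hne) (collapse_mem hqy hq hx)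
      (collapse_mem hqy hq hz)

theorem Joined.of_pull {a b x : W} (hqy : T.Adj q y) (hx : x ≠ y)
    (h : Joined (pullGraph T q y) {x}ᶜ (collapse q y a) (collapse q y b)) :
    Joined T {x}ᶜ a b := by
  have key : ∀ u ∈ ({x}ᶜ : Set W), ∀ v ∈ ({x}ᶜ : Set W),
      (T.Adj u v ∧ u ≠ y ∧ v ≠ y) ∨ (u = q ∧ T.Adj y v) ∨ (u = q ∧ v = y) →
      Joined T {x}ᶜ u v := by
    rintro u hu v hv (h | ⟨rfl, h'⟩ | ⟨rfl, rfl⟩)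
    · exact .of_adj h.1 hu hv
    · exact (Joined.of_adj hqy hu hx.symm).trans (.of_adj h' hx.symm hv)
    · exact .of_adj hqy hu hv
  have main : Joined T {x}ᶜ (collapse q y a) (collapse q y b) := by
    refine h.lift id (fun _ h => h) fun u hu v hv huv => ?_
    rcases (SimpleGraph.fromRel_adj _ _ _).1 huv with ⟨-, huv | huv⟩
    exacts [key u hu v hv huv, (key v hv u hu huv).symm]
  have stay : ∀ z, collapse q y z ∈ ({x}ᶜ : Set W) → Joined T {x}ᶜ z (collapse q y z) := by
    intro z hz
    by_cases hzy : z = y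
    · subst hzy
      rw [collapse_self] at hz ⊢
      exact .of_adj hqy.symm hx.symm hz
    · rw [collapse_of_ne hzy] at hz ⊢
      exact .refl hz
  exact ((stay a main.left_mem).trans main).trans (stay b main.right_mem).symm

theorem IsSubpath.pull (hT : T.IsTree) (hqy : T.Adj q y) (hP : IsSubpath T P)
    (hq : y ∈ P → q ∈ P) : IsSubpath (pullGraph T q y) (P \ {y}) := by
  obtain ⟨a, b, hab, hbt⟩ := hP.exists_between hT.2
  refine isSubpath_of_between (hab.pull hqy.ne hq) fun x hx => ?_
  by_contra hcon
  exact not_between_iff.2 ((not_between_iff.1 hcon).of_pull hqy hx.2) (hbt x hx.1)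

/-- Keeping `y` as a leaf leaves the vertex set unchanged; each edge comes from an old one, with
`qy` fixed. -/
theorem isTree_pullGraph [Finite W] (hT : T.IsTree) (hqy : T.Adj q y) :
    (pullGraph T q y).IsTree := by
  classical
  have hadj : (pullGraph T q y).Adj q y :=
    (SimpleGraph.fromRel_adj _ _ _).2 ⟨hqy.ne, .inl (.inr (.inr ⟨rfl, rfl⟩))⟩
  refine isTree_of_edges_le ?_ ?_
  · refine SimpleGraph.connected_iff_exists_forall_reachable _ |>.2 ⟨q, fun x => ?_⟩
    by_cases hx : x = y
    · subst hx; exact hadj.reachable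
    · obtain ⟨p, -⟩ := (joined_univ hT.1 q x).pull hqy.ne fun _ => Set.mem_univ q
      rw [collapse_of_ne hqy.ne, collapse_of_ne hx] at p
      exact p.reachable
  · let g : Sym2 W → Sym2 W := fun e => if e = s(q, y) then s(q, y) else e.map (collapse q y)
    have key : ∀ a b, a ≠ b →
        (T.Adj a b ∧ a ≠ y ∧ b ≠ y) ∨ (a = q ∧ T.Adj y b) ∨ (a = q ∧ b = y) →
        s(a, b) ∈ g '' T.edgeSet := by
      rintro a b hne (h | ⟨rfl, h⟩ | ⟨rfl, rfl⟩)
      · refine ⟨s(a, b), h.1, ?_⟩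
        have h1 : s(a, b) ≠ s(q, y) := by rw [Ne, Sym2.eq_iff]; tauto
        simp [g, if_neg h1, collapse_of_ne h.2.1, collapse_of_ne h.2.2]
      · refine ⟨s(y, b), h, ?_⟩
        have h1 : s(y, b) ≠ s(a, y) := by
          rw [Sym2.eq_swap, Ne, Sym2.congr_left]; exact hne.symm
        simp [g, if_neg h1, collapse_self, collapse_of_ne h.ne']
      · exact ⟨s(a, b), hqy, by simp [g]⟩
    have hsub : (pullGraph T q y).edgeSet ⊆ g '' T.edgeSet := by
      rintro ⟨a, b⟩ h
      rcases (SimpleGraph.fromRel_adj _ _ _).1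
        (show (pullGraph T q y).Adj a b from h) with ⟨hne, h | h⟩
      · exact key a b hne h
      · rw [show Quot.mk _ (a, b) = s(b, a) from Sym2.eq_swap]
        exact key b a hne.symm h
    have h1 := Set.ncard_le_ncard hsub (Set.toFinite _)
    have h3 := Set.ncard_image_le (f := g) (Set.toFinite T.edgeSet)
    have h4 := (SimpleGraph.isTree_iff_connected_and_card.1 hT).2
    have h5 : T.edgeSet.ncard = Nat.card T.edgeSet := rfl
    omega

/-- No vertex that is used by some path has all its paths passing through one neighbour. -/
def IsTight {V : Type*} (T : SimpleGraph W) (P : V → Set W) : Prop :=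
  ∀ q y, T.Adj q y → ∀ v, y ∈ P v → ∃ w, y ∈ P w ∧ q ∉ P w

theorem IsVPTRep.pull {V : Type u} {G : SimpleGraph V} [Finite W] {P : V → Set W}
    (h : IsVPTRep G T P) (hqy : T.Adj q y) (hq : ∀ v, y ∈ P v → q ∈ P v) :
    IsVPTRep G (pullGraph T q y) (fun v => P v \ {y}) where
  isTree := isTree_pullGraph h.isTree hqy
  isSubpath v := (h.isSubpath v).pull h.isTree hqy (hq v)
  adj_iff v w hvw := by
    rw [h.adj_iff v w hvw]
    constructor
    · rintro ⟨x, hx, hx'⟩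
      exact ⟨_, collapse_mem hqy.ne (hq v) hx, collapse_mem hqy.ne (hq w) hx'⟩
    · rintro ⟨x, hx, hx'⟩
      exact ⟨x, hx.1, hx'.1⟩

/-- Each pull removes `y` from all paths and from at least one, so the total size of the paths
drops. -/
theorem exists_isTight_aux {V : Type u} [Fintype V] {G : SimpleGraph V} [Finite W] (n : ℕ) :
    ∀ {T : SimpleGraph W} {P : V → Set W}, IsVPTRep G T P → ∑ v, (P v).ncard = n →
      ∃ (T : SimpleGraph W) (P : V → Set W), IsVPTRep G T P ∧ IsTight T P := by
  induction n using Nat.strong_induction_on with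
  | _ n ih =>
  intro T P h hn
  by_cases ht : IsTight T P
  · exact ⟨T, P, h, ht⟩
  simp only [IsTight, not_forall, not_exists, not_and, not_not] at ht
  obtain ⟨q, y, hqy, v, hv, hq⟩ := ht
  refine ih _ ?_ (h.pull hqy hq) rfl
  rw [← hn]
  exact Finset.sum_lt_sum (fun w _ => Set.ncard_le_ncard Set.sdiff_subset (Set.toFinite _))
    ⟨v, Finset.mem_univ _, Set.ncard_sdiff_singleton_lt_of_mem hv (Set.toFinite _)⟩

theorem IsVPT.exists_isTight {V : Type u} [Finite V] {G : SimpleGraph V} (h : IsVPT G) :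
    ∃ (W : Type u) (_ : Finite W) (T : SimpleGraph W) (P : V → Set W),
      IsVPTRep G T P ∧ IsTight T P := by
  obtain ⟨W, _, T, P, h⟩ := h
  have := Fintype.ofFinite V
  exact ⟨W, inferInstance, exists_isTight_aux _ h rfl⟩

end Pull

/-! ### Passing to induced subgraphs -/

section Hereditary

theorem IsVPTRep.comap {V V' W : Type u} {G : SimpleGraph V} {G' : SimpleGraph V'}
    {T : SimpleGraph W} {P : V → Set W} (h : IsVPTRep G T P) (f : G' ↪g G) :
    IsVPTRep G' T (P ∘ f) where
  isTree := h.isTree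
  isSubpath v := h.isSubpath _
  adj_iff v w hvw := by
    rw [← f.map_adj_iff]
    exact h.adj_iff _ _ (f.injective.ne hvw)

theorem InClass.comap {h : ℕ} {V V' : Type u} {G : SimpleGraph V} {G' : SimpleGraph V'}
    (hG : InClass h G) (f : G' ↪g G) : InClass h G' := by
  obtain ⟨W, hW, T, P, hrep, hdeg⟩ := hG
  exact ⟨W, hW, T, P ∘ f, hrep.comap f, hdeg⟩

end Hereditary

/-! ### Representations on a star -/

section Star

variable {U V : Type u}

/-- The subset of the star with centre `none` and leaves `U` consisting of the leaves in `N` and,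
if `p` holds, of the centre. -/
def starSet (p : Prop) (N : Set U) : Set (Option U) :=
  {z | match z with
    | none => p
    | some u => u ∈ N}

theorem isSubpath_starSet_of_mem {N : Set U} {p : Prop} (hp : p)
    (hN : N = ∅ ∨ ∃ a b, N = {a, b}) :
    IsSubpath (SimpleGraph.starGraph (none : Option U)) (starSet p N) := by
  have hadj : ∀ a : U, (SimpleGraph.starGraph (none : Option U)).Adj none (some a) := by simp
  rcases hN with rfl | ⟨a, b, rfl⟩
  · refine ⟨none, none, .nil, .nil, ?_⟩
    ext (_ | u) <;> simp [starSet, hp]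
  · by_cases hab : a = b
    · subst hab
      refine ⟨none, some a, .cons (hadj a) .nil, by simp, ?_⟩
      ext (_ | u) <;> simp [starSet, hp]
    · refine ⟨some a, some b, .cons (hadj a).symm (.cons (hadj b) .nil), ?_, ?_⟩
      · simp [SimpleGraph.Walk.cons_isPath_iff, hab]
      · ext (_ | u) <;> simp [starSet, hp]

theorem isSubpath_starSet_singleton {p : Prop} (hp : ¬ p) (a : U) :
    IsSubpath (SimpleGraph.starGraph (none : Option U)) (starSet p {a}) := by
  refine ⟨some a, some a, .nil, .nil, ?_⟩
  ext (_ | u) <;> simp [starSet, hp]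

/-- A graph with a representation on a star is in `[h,2,1]` if the leaves have an `h`-colouring
with distinct colours on the two ends of each path through the centre. -/
theorem inClass_of_star {h : ℕ} (hh : 3 ≤ h) [Finite U] {G : SimpleGraph V} (K : V → Prop)
    (N : V → Set U) (c : U → Fin h) (hK : ∀ v, K v → N v = ∅ ∨ ∃ a b, N v = {a, b})
    (hS : ∀ v, ¬ K v → ∃ a, N v = {a})
    (hadj : ∀ v w, v ≠ w → (G.Adj v w ↔ (K v ∧ K w) ∨ (N v ∩ N w).Nonempty))
    (hc : ∀ v, K v → ∀ a ∈ N v, ∀ b ∈ N v, c a = c b → a = b) : InClass h G := by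
  refine inClass_of_separates hh (T := SimpleGraph.starGraph (none : Option U))
    (P := fun v => starSet (K v) (N v)) ⟨SimpleGraph.isTree_starGraph _, fun v => ?_, ?_⟩ ?_
  · by_cases hv : K v
    · exact isSubpath_starSet_of_mem hv (hK v hv)
    · obtain ⟨a, ha⟩ := hS v hv
      simp only [ha]
      exact isSubpath_starSet_singleton hv a
  · intro v w hvw
    rw [hadj v w hvw]
    constructor
    · rintro (h | ⟨u, h⟩)
      exacts [⟨none, h⟩, ⟨some u, h⟩]
    · rintro ⟨_ | u, h⟩
      exacts [.inl h, .inr ⟨u, h⟩]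
  · rintro (_ | u) -
    -- The colour of the centre is arbitrary: it is not its own neighbour.
    · refine ⟨fun z => z.elim ⟨0, by omega⟩ c, ?_⟩
      rintro v hv (_ | a) ha (_ | b) hb hqa hqb hab
      · rfl
      · exact absurd hqa (SimpleGraph.irrefl _)
      · exact absurd hqb (SimpleGraph.irrefl _)
      · exact congrArg some (hc v hv a ha b hb hab)
    -- A leaf has a single neighbour, so any colouring separates.
    · refine ⟨fun _ => ⟨0, by omega⟩, ?_⟩
      rintro v hv y hy y' hy' hqy hqy' -
      simp at hqy hqy'
      rw [hqy.2, hqy'.2]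

end Star

/-! ### Critical graphs -/

section Critical

variable {U : Type u} {H : SimpleGraph U} {h : ℕ}

theorem colorable_of_induce_compl (hh : 2 ≤ h) {v : U} (hc : (H.induce {v}ᶜ).Colorable h)
    (hv : ∀ w w', H.Adj v w → H.Adj v w' → w = w') : H.Colorable h := by
  classical
  obtain ⟨c⟩ := hc
  obtain ⟨k, hk⟩ : ∃ k : Fin h, ∀ w (hw : w ∈ ({v}ᶜ : Set U)), H.Adj v w → c ⟨w, hw⟩ ≠ k := by
    by_cases hw : ∃ w, H.Adj v w
    · obtain ⟨w, hw⟩ := hw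
      have : Nontrivial (Fin h) := Fin.nontrivial_iff_two_le.2 hh
      obtain ⟨k, hk⟩ := exists_ne (c ⟨w, hw.ne'⟩)
      refine ⟨k, fun w' hw' hvw' => ?_⟩
      obtain rfl := hv w w' hw hvw'
      exact hk.symm
    · exact ⟨⟨0, by omega⟩, fun w _ hvw => (hw ⟨w, hvw⟩).elim⟩
  refine ⟨SimpleGraph.Coloring.mk (fun u => if hu : u ∈ ({v}ᶜ : Set U) then c ⟨u, hu⟩ else k) ?_⟩
  intro a b hab
  by_cases ha : a = v
  · subst ha
    simpa [hab.ne'] using (hk b hab.ne' hab).symm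
  · by_cases hb : b = v
    · subst hb
      simpa [hab.ne] using hk a ha hab.symm
    · have := c.valid (v := ⟨a, ha⟩) (w := ⟨b, hb⟩) hab
      simpa [ha, hb] using this

theorem colorable_succ_of_induce_compl {v : U} (hc : (H.induce {v}ᶜ).Colorable h) :
    H.Colorable (h + 1) := by
  classical
  obtain ⟨c⟩ := hc
  refine ⟨SimpleGraph.Coloring.mk
    (fun u => if hu : u ∈ ({v}ᶜ : Set U) then (c ⟨u, hu⟩).castSucc else Fin.last h) ?_⟩
  intro a b hab
  by_cases ha : a = v
  · subst ha
    simp [hab.ne', (Fin.castSucc_lt_last _).ne']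
  · by_cases hb : b = v
    · subst hb
      simp [hab.ne, (Fin.castSucc_lt_last _).ne]
    · have := c.valid (v := ⟨a, ha⟩) (w := ⟨b, hb⟩) hab
      simpa [ha, hb] using this

theorem IsCritical.not_colorable (hH : IsCritical (h + 1) H) : ¬ H.Colorable h := by
  rw [← SimpleGraph.chromaticNumber_le_iff_colorable, hH.1]
  exact_mod_cast Nat.not_succ_le_self h

theorem colorable_of_chromaticNumber_lt {U' : Type*} {H' : SimpleGraph U'}
    (hH : H.chromaticNumber = (h + 1 : ℕ)) (hlt : H'.chromaticNumber < H.chromaticNumber) :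
    H'.Colorable h := by
  rw [hH, Nat.cast_add, Nat.cast_one] at hlt
  exact SimpleGraph.chromaticNumber_le_iff_colorable.1 (Order.le_of_lt_add_one hlt)

theorem IsCritical.colorable_induce (hH : IsCritical (h + 1) H) (v : U) :
    (H.induce {v}ᶜ).Colorable h :=
  colorable_of_chromaticNumber_lt hH.1 (hH.2.1 v)

theorem IsCritical.colorable_deleteEdges (hH : IsCritical (h + 1) H) {e : Sym2 U}
    (he : e ∈ H.edgeSet) : (H.deleteEdges {e}).Colorable h :=
  colorable_of_chromaticNumber_lt hH.1 (hH.2.2 e he)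

/-- A vertex with at most one neighbour could be added back to an `h`-coloured `H - v`. This rules
out the `extra` vertices of `G_H`. -/
theorem IsCritical.exists_two_neighbors (hh : 2 ≤ h) (hH : IsCritical (h + 1) H) (v : U) :
    ∃ w w', H.Adj v w ∧ H.Adj v w' ∧ w ≠ w' := by
  by_contra! hcon
  exact hH.not_colorable (colorable_of_induce_compl hh (hH.colorable_induce v)
    fun w w' hw hw' => hcon w w' hw hw')

theorem IsCritical.ncard_neighborSet_ne_one (hh : 2 ≤ h) (hH : IsCritical (h + 1) H) (v : U) :
    (H.neighborSet v).ncard ≠ 1 := by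
  obtain ⟨w, w', hw, hw', hne⟩ := hH.exists_two_neighbors hh v
  rw [Ne, Set.ncard_eq_one]
  rintro ⟨a, ha⟩
  have h1 : w ∈ H.neighborSet v := hw
  have h2 : w' ∈ H.neighborSet v := hw'
  rw [ha] at h1 h2
  exact hne (h1.trans h2.symm)

theorem isCritical_of_colorable (hH : ¬ H.Colorable h)
    (hv : ∀ v, (H.induce {v}ᶜ).Colorable h)
    (he : ∀ e ∈ H.edgeSet, (H.deleteEdges {e}).Colorable h) : IsCritical (h + 1) H := by
  have hlt : (h : ℕ∞) < (h + 1 : ℕ) := by exact_mod_cast Nat.lt_succ_self h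
  have hχ : H.chromaticNumber = (h + 1 : ℕ) := by
    obtain ⟨v⟩ : Nonempty U := by
      by_contra hne
      rw [not_nonempty_iff] at hne
      exact hH (SimpleGraph.Colorable.of_isEmpty _)
    refine le_antisymm (colorable_succ_of_induce_compl (hv v)).chromaticNumber_le ?_
    rw [← not_lt, Nat.cast_add, Nat.cast_one]
    exact fun h => hH (SimpleGraph.chromaticNumber_le_iff_colorable.1 (Order.le_of_lt_add_one h))
  exact ⟨hχ, fun v => hχ ▸ (hv v).chromaticNumber_le.trans_lt hlt,
    fun e hee => hχ ▸ (he e hee).chromaticNumber_le.trans_lt hlt⟩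

/-- Delete vertices and edges as long as the graph stays non-`h`-colourable. The result is a
subgraph, not necessarily induced, hence the one-way implication for `f`. -/
theorem exists_isCritical_aux (n : ℕ) :
    ∀ {U : Type u} [Finite U] {H : SimpleGraph U}, ¬ H.Colorable h →
      Nat.card U + H.edgeSet.ncard = n →
      ∃ (U' : Type u) (_ : Finite U') (H' : SimpleGraph U') (f : U' → U),
        IsCritical (h + 1) H' ∧ Function.Injective f ∧
          ∀ a b, H'.Adj a b → H.Adj (f a) (f b) := by
  induction n using Nat.strong_induction_on with
  | _ n ih =>
  intro U _ H hH hn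
  by_cases hv : ∀ v, (H.induce {v}ᶜ).Colorable h
  · by_cases he : ∀ e ∈ H.edgeSet, (H.deleteEdges {e}).Colorable h
    · exact ⟨U, inferInstance, H, id, isCritical_of_colorable hH hv he, fun _ _ h => h,
        fun _ _ h => h⟩
    push Not at he
    obtain ⟨e, he, hne⟩ := he
    obtain ⟨U', hU', H', f, hH', hf, hadj⟩ := ih _ (by
      rw [← hn, SimpleGraph.edgeSet_deleteEdges]
      exact Nat.add_lt_add_left (Set.ncard_sdiff_singleton_lt_of_mem he (Set.toFinite _)) _)
      hne rfl
    exact ⟨U', hU', H', f, hH', hf, fun a b hab => (SimpleGraph.deleteEdges_adj.1 (hadj a b hab)).1⟩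
  · push Not at hv
    obtain ⟨v, hne⟩ := hv
    obtain ⟨U', hU', H', f, hH', hf, hadj⟩ := ih _ (by
      rw [← hn]
      refine Nat.add_lt_add_of_lt_of_le ?_ ?_
      · exact Finite.card_subtype_lt (x := v) (by simp)
      · let g := (SimpleGraph.Embedding.induce (G := H) ({v}ᶜ : Set U))
        exact Nat.card_le_card_of_injective _ g.mapEdgeSet.injective)
      hne rfl
    exact ⟨U', hU', H', fun a => (f a).1, hH', Subtype.val_injective.comp hf, hadj⟩

theorem exists_isCritical [Finite U] (hH : ¬ H.Colorable h) :
    ∃ (U' : Type u) (_ : Finite U') (H' : SimpleGraph U') (f : U' → U),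
      IsCritical (h + 1) H' ∧ Function.Injective f ∧ ∀ a b, H'.Adj a b → H.Adj (f a) (f b) :=
  exists_isCritical_aux _ hH rfl

end Critical

/-! ### The graphs `G_H`: minimality and embedding -/

section GH

variable {U : Type u} {H : SimpleGraph U} {h : ℕ}

/-- The leaves, in the natural star representation of `G_H` without its vertex `x`, of the path
of a vertex. -/
def starLeaves (x : GHVertex H) : GHVertex H → Set U
  | .stable u => {u}
  | .edge e => {w | w ∈ e.1 ∧ .stable w ≠ x}
  | .extra w _ => {w}

/-- The clique vertices of `G_H`. -/
def IsCliqueVertex : GHVertex H → Prop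
  | .stable _ => False
  | .edge _ => True
  | .extra _ _ => True

/-- The clique paths pass through the centre of a star with leaves `U`. Only edges untouched by the
deletion of `x` need ends of different colours. -/
theorem inClass_GH_induce (hh : 3 ≤ h) [Finite U] (hextra : ∀ v, (H.neighborSet v).ncard ≠ 1)
    (x : GHVertex H) (c : U → Fin h)
    (hc : ∀ a b, H.Adj a b → .stable a ≠ x → .stable b ≠ x →
      (∀ e : H.edgeSet, e.1 = s(a, b) → .edge e ≠ x) → c a ≠ c b) :
    InClass h ((GH H).induce {x}ᶜ) := by
  refine inClass_of_star hh (fun v => IsCliqueVertex v.1) (fun v => starLeaves x v.1) c ?_ ?_ ?_ ?_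
  · rintro ⟨u | ⟨⟨a, b⟩, he⟩ | ⟨u, hu⟩, hv⟩ hK
    · exact hK.elim
    · have hsub : starLeaves x (.edge ⟨s(a, b), he⟩) ⊆ {a, b} := fun w hw => by
        simpa using Sym2.mem_iff.1 hw.1
      rcases Set.subset_pair_iff_eq.1 hsub with h | h | h | h
      · exact .inl h
      · exact .inr ⟨a, a, by simpa using h⟩
      · exact .inr ⟨b, b, by simpa using h⟩
      · exact .inr ⟨a, b, h⟩
    · exact (hextra u hu).elim
  · rintro ⟨u | e | ⟨u, hu⟩, hv⟩ hK
    · exact ⟨u, rfl⟩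
    · exact (hK trivial).elim
    · exact (hK trivial).elim
  · rintro ⟨u | e | ⟨u, hu⟩, hv⟩ ⟨w | f | ⟨w, hw⟩, hv'⟩ hne
    · have : u ≠ w := fun h => hne (by simp [h])
      simp [GH, GHAdj, IsCliqueVertex, starLeaves, this.symm]
    · have hu : GHVertex.stable u ≠ x := hv
      simp [GH, GHAdj, IsCliqueVertex, starLeaves, hu]
    · exact (hextra w hw).elim
    · have hw : GHVertex.stable w ≠ x := hv'
      simp [GH, GHAdj, IsCliqueVertex, starLeaves, hw]
    · have : e ≠ f := fun h => hne (by simp [h])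
      simp [GH, GHAdj, IsCliqueVertex, this]
    · exact (hextra w hw).elim
    all_goals exact (hextra u hu).elim
  · rintro ⟨u | ⟨e, he⟩ | ⟨u, hu⟩, hv⟩ hK a ha b hb hab
    · exact hK.elim
    · by_contra hne
      have hes : e = s(a, b) := (Sym2.mem_and_mem_iff hne).1 ⟨ha.1, hb.1⟩
      subst hes
      refine hc a b he ha.2 hb.2 (fun f hf => ?_) hab
      rwa [show f = ⟨s(a, b), he⟩ from Subtype.ext hf]
    · exact (hextra u hu).elim

theorem IsCritical.inClass_GH_induce (hh : 3 ≤ h) [Finite U] (hH : IsCritical (h + 1) H)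
    (x : GHVertex H) : InClass h ((GH H).induce {x}ᶜ) := by
  classical
  have hextra := hH.ncard_neighborSet_ne_one (by omega)
  rcases x with v | ⟨e, he⟩ | ⟨v, hv⟩
  · obtain ⟨c⟩ := hH.colorable_induce v
    refine VPT.inClass_GH_induce hh hextra _
      (fun u => if hu : u ∈ ({v}ᶜ : Set U) then c ⟨u, hu⟩ else ⟨0, by omega⟩)
      fun a b hab ha hb _ => ?_
    have ha : a ≠ v := fun h => ha (by rw [h])
    have hb : b ≠ v := fun h => hb (by rw [h])
    have := c.valid (v := ⟨a, ha⟩) (w := ⟨b, hb⟩) hab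
    simpa [ha, hb] using this
  · obtain ⟨c⟩ := hH.colorable_deleteEdges he
    refine VPT.inClass_GH_induce hh hextra _ c fun a b hab _ _ hne => c.valid ?_
    rw [SimpleGraph.deleteEdges_adj]
    exact ⟨hab, fun h => hne ⟨s(a, b), hab⟩ rfl (by congr)⟩
  · exact (hextra v hv).elim

theorem exists_adj_joined {W : Type*} {T : SimpleGraph W} (hT : T.Connected) {q x : W}
    (h : x ≠ q) : ∃ y, T.Adj q y ∧ Joined T {q}ᶜ y x := by
  obtain ⟨p, hp, -⟩ := (joined_univ hT q x).exists_path
  cases p with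
  | nil => exact (h rfl).elim
  | cons hadj p =>
    rw [SimpleGraph.Walk.cons_isPath_iff] at hp
    exact ⟨_, hadj, p, fun z hz e => hp.2 (e ▸ hz)⟩

/-- A representation with degrees at most `h` would give an `h`-colouring of `H`: the colour of `v`
is the neighbour of `q` towards the path of `s_v`. -/
theorem IsCritical.not_inClass_GH (hh : 3 ≤ h) [Finite U] (hH : IsCritical (h + 1) H) :
    ¬ InClass h (GH H) := by
  classical
  rintro ⟨W, _, T, P, hrep, hdeg⟩
  have hT := hrep.isTree
  have htwo := hH.exists_two_neighbors (by omega)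
  have := Fintype.ofFinite H.edgeSet
  have hconn := fun v => (hrep.isSubpath v).conn
  obtain ⟨q, hq⟩ := helly hT (Finset.univ : Finset H.edgeSet) (fun e => P (.edge e))
    (fun e _ => hconn _) (fun e _ f _ => by
      by_cases hef : e = f
      · subst hef
        simpa using (hrep.isSubpath (.edge e)).nonempty
      · exact (hrep.adj_iff (.edge e) (.edge f) (by simpa using hef)).1 hef)
  have hq : ∀ e, q ∈ P (.edge e) := fun e => hq e (Finset.mem_univ e)
  have hinc : ∀ (v : U) (e : H.edgeSet), v ∈ e.1 ↔ (P (.stable v) ∩ P (.edge e)).Nonempty :=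
    fun v e => hrep.adj_iff (.stable v) (.edge e) (by simp)
  -- A neighbour `w` of `v` has an edge `ww'` that misses `v`; were `q` on the path of `s_v`, that
  -- edge would contain `v`.
  have hqs : ∀ v, q ∉ P (.stable v) := by
    intro v hv
    obtain ⟨w, -, hvw, -, -⟩ := htwo v
    obtain ⟨w', hww', hne⟩ : ∃ w', H.Adj w w' ∧ w' ≠ v := by
      obtain ⟨a, b, ha, hb, hab⟩ := htwo w
      by_cases hav : a = v
      · exact ⟨b, hb, fun h => hab (hav.trans h.symm)⟩
      · exact ⟨a, ha, hav⟩
    have := (hinc v ⟨s(w, w'), hww'⟩).2 ⟨q, hv, hq _⟩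
    rcases Sym2.mem_iff.1 this with h | h
    exacts [hvw.ne h, hne h.symm]
  choose x hx hgate using fun v =>
    exists_gate hT (hconn (.stable v)) (hrep.isSubpath (.stable v)).nonempty q
  have hxq : ∀ v, x v ≠ q := fun v hv => hqs v (hv ▸ hx v)
  choose y hy hyx using fun v => exists_adj_joined hT.1 (hxq v)
  have hxe : ∀ v (e : H.edgeSet), v ∈ e.1 → x v ∈ P (.edge e) := by
    intro v e hv
    obtain ⟨a, ha, ha'⟩ := (hinc v e).1 hv
    exact (hgate v a ha).mem (hconn _ a ha' q (hq e))
  -- Otherwise every path of an edge at `w` would meet the path of `s_v` on its way from `q`,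
  -- leaving `w` with the sole neighbour `v`.
  have hnest : ∀ v w, v ≠ w → ¬ Between T q (x v) (x w) := by
    intro v w hvw hb
    have key : ∀ a, H.Adj w a → a = v := by
      intro a ha
      have h1 := hb.mem (hconn _ q (hq ⟨s(w, a), ha⟩) _ (hxe w _ (Sym2.mem_mk_left w a)))
      rcases Sym2.mem_iff.1 ((hinc v ⟨s(w, a), ha⟩).2 ⟨_, hx v, h1⟩) with h | h
      exacts [(hvw h).elim, h.symm]
    obtain ⟨a, b, ha, hb, hab⟩ := htwo w
    exact hab ((key a ha).trans (key b hb).symm)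
  let e := Finite.equivFin (T.neighborSet q)
  refine hH.not_colorable ⟨SimpleGraph.Coloring.mk
    (fun v => Fin.castLE (hdeg q) (e ⟨y v, hy v⟩)) fun {v w} hvw hcol => ?_⟩
  have hyy : y v = y w := congrArg Subtype.val (e.injective (Fin.castLE_injective _ hcol))
  -- The path of the edge `vw` contains `x v`, `x w` and `q`. Equal colours put both gates in one
  -- branch, so `q` is not the middle one; `hnest` excludes the other two orders.
  rcases (hrep.isSubpath (.edge ⟨s(v, w), hvw⟩)).between hT.2
    (hxe v _ (Sym2.mem_mk_left v w)) (hxe w _ (Sym2.mem_mk_right v w)) (hq _) with hb | hb | hb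
  · exact not_between_iff.2 ((hyx v).symm.trans (hyy ▸ hyx w)) hb
  · exact hnest v w hvw.ne hb
  · exact hnest w v hvw.ne' hb

/-- The vertices `y`, `y'` next to `q` are adjacent if some path passes through `y`, `q`, `y'`. -/
def passGraph {V W : Type*} (T : SimpleGraph W) (P : V → Set W) (q : W) : SimpleGraph W where
  Adj y y' := y ≠ y' ∧ T.Adj q y ∧ T.Adj q y' ∧ ∃ v, q ∈ P v ∧ y ∈ P v ∧ y' ∈ P v
  symm := ⟨fun _ _ ⟨h, h1, h2, v, hq, h3, h4⟩ => ⟨h.symm, h2, h1, v, hq, h4, h3⟩⟩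
  loopless := ⟨fun _ h => h.1 rfl⟩

theorem exists_separates_of_colorable {V W : Type*} {T : SimpleGraph W} {P : V → Set W} {q : W}
    (hc : (passGraph T P q).Colorable h) : ∃ c : W → Fin h, Separates T P q c := by
  obtain ⟨c⟩ := hc
  refine ⟨c, fun v hq y hy y' hy' hqy hqy' hcy => ?_⟩
  by_contra hne
  exact c.valid ⟨hne, hqy, hqy', v, hq, hy, hy'⟩ hcy

/-- Stable vertices become paths through `f u` that avoid `q`, provided by tightness; edges become
the paths through `q` that witness adjacency in `passGraph`. -/
theorem exists_GH_embedding {V W : Type u} {G : SimpleGraph V} {T : SimpleGraph W}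
    {P : V → Set W} (hrep : IsVPTRep G T P) (ht : IsTight T P) {q : W}
    (hnb : ∀ u, ∃ w, H.Adj u w) (hextra : ∀ v, (H.neighborSet v).ncard ≠ 1)
    {f : U → W} (hf : Function.Injective f)
    (hadj : ∀ a b, H.Adj a b → (passGraph T P q).Adj (f a) (f b)) :
    Nonempty (GH H ↪g G) := by
  have hT := hrep.isTree
  have hconn := fun v => (hrep.isSubpath v).conn
  have hqf : ∀ u, T.Adj q (f u) := fun u => by
    obtain ⟨w, hw⟩ := hnb u
    exact (hadj u w hw).2.1
  have hs : ∀ u, ∃ v, f u ∈ P v ∧ q ∉ P v := fun u => by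
    obtain ⟨w, hw⟩ := hnb u
    obtain ⟨v, -, hv, -⟩ := (hadj u w hw).2.2.2
    exact ht q (f u) (hqf u) v hv
  choose s hs hqs using hs
  have hk : ∀ e : H.edgeSet, ∃ v, q ∈ P v ∧ ∀ u, f u ∈ P v ↔ u ∈ e.1 := by
    rintro ⟨⟨a, b⟩, he⟩
    obtain ⟨hne, hqa, hqb, v, hq, ha, hb⟩ := hadj a b he
    refine ⟨v, hq, fun u => ⟨fun hu => ?_, fun hu => ?_⟩⟩
    -- A path contains at most two neighbours of `q`, so it meets the image of `f` in the ends of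
    -- the edge only.
    · exact Sym2.mem_iff.2 (((hrep.isSubpath v).eq_or_eq hT.2 ha hb hu hqa hqb (hqf u) hne).imp
        (fun h => hf h) fun h => hf h)
    · rcases Sym2.mem_iff.1 hu with rfl | rfl
      exacts [ha, hb]
  choose k hqk hk using hk
  -- If two such paths met, their union would join `f u` to `f w` and so contain `q`.
  have hSS : ∀ u w, (P (s u) ∩ P (s w)).Nonempty → u = w := by
    rintro u w ⟨z, hz, hz'⟩
    by_contra hne
    have := (between_of_adj_of_adj hT.2 (hqf u).symm (hqf w) (hf.ne hne)).mem
      (((hconn (s u)).union (hconn (s w)) hz hz') _ (.inl (hs u)) _ (.inr (hs w)))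
    exact this.elim (hqs u) (hqs w)
  have hSK : ∀ u e, (P (s u) ∩ P (k e)).Nonempty ↔ u ∈ e.1 := by
    refine fun u e => ⟨?_, fun hu => ⟨f u, hs u, (hk e u).2 hu⟩⟩
    rintro ⟨z, hz, hz'⟩
    -- A common point lies in the branch of `f u` at `q`, so the path of `e` crosses `f u` to reach
    -- `q`.
    have hj : Joined T {q}ᶜ z (f u) :=
      (hconn (s u) z hz _ (hs u)).mono fun a ha e => hqs u (e ▸ ha)
    exact (hk e u).1 ((between_of_joined_compl hT.2 (hqf u).symm hj).mem
      (hconn (k e) z hz' q (hqk e)))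
  have hsk : ∀ u e, s u ≠ k e := fun u e h => hqs u (h ▸ hqk e)
  have hkk : Function.Injective k := fun e e' h =>
    Subtype.ext (Sym2.ext fun u => by rw [← hk, ← hk, h])
  have hss : Function.Injective s := fun u w h => hSS u w ⟨f u, hs u, h ▸ hs u⟩
  let φ : GHVertex H → V
    | .stable u => s u
    | .edge e => k e
    | .extra v hv => (hextra v hv).elim
  have hφ : Function.Injective φ := by
    rintro (u | e | ⟨u, hu⟩) (w | e' | ⟨w, hw⟩) heq
    · rw [hss heq]
    · exact (hsk u e' heq).elim
    · exact (hextra w hw).elim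
    · exact (hsk w e heq.symm).elim
    · rw [hkk heq]
    · exact (hextra w hw).elim
    all_goals exact (hextra u hu).elim
  refine ⟨⟨⟨φ, hφ⟩, fun {a b} => ?_⟩⟩
  by_cases hab : a = b
  · subst hab; simp
  refine (hrep.adj_iff _ _ (hφ.ne hab)).trans ?_
  rcases a with u | e | ⟨u, hu⟩ <;> rcases b with w | e' | ⟨w, hw⟩
  · exact ⟨fun h => (hab (congrArg _ (hSS u w h))).elim, fun h => h.elim⟩
  · exact hSK u e'
  · exact (hextra w hw).elim
  · rw [Set.inter_comm]
    exact hSK w e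
  · exact ⟨fun _ h => hab (congrArg _ h), fun _ => ⟨q, hqk e, hqk e'⟩⟩
  · exact (hextra w hw).elim
  all_goals exact (hextra u hu).elim

/-- A VPT graph outside `[h,2,1]` contains `G_H` for some `(h+1)`-critical graph `H`. -/
theorem IsVPT.exists_GH_embedding {V : Type u} [Finite V] {G : SimpleGraph V} (hh : 3 ≤ h)
    (hG : IsVPT G) (hn : ¬ InClass h G) :
    ∃ (U : Type u) (_ : Finite U) (H : SimpleGraph U),
      IsCritical (h + 1) H ∧ Nonempty (GH H ↪g G) := by
  obtain ⟨W, _, T, P, hrep, ht⟩ := hG.exists_isTight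
  obtain ⟨q, hq⟩ : ∃ q, ¬ (passGraph T P q).Colorable h := by
    by_contra! hcon
    exact hn (inClass_of_separates hh hrep fun q _ => exists_separates_of_colorable (hcon q))
  obtain ⟨U, hU, H, f, hH, hf, hadj⟩ := exists_isCritical hq
  refine ⟨U, hU, H, hH, VPT.exists_GH_embedding hrep ht (fun u => ?_)
    (hH.ncard_neighborSet_ne_one (by omega)) hf hadj⟩
  obtain ⟨w, -, hw, -⟩ := hH.exists_two_neighbors (by omega) u
  exact ⟨w, hw⟩

end GH

end VPT

theorem theorem5p1 (h : ℕ) (hh : 3 ≤ h) {V : Type u} [Finite V] (G : SimpleGraph V)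
    (hG : VPT.IsVPT G) :
    VPT.IsMinimalNon h G ↔
      ∃ (U : Type u) (_ : Finite U) (H : SimpleGraph U),
        VPT.IsCritical (h + 1) H ∧ Nonempty (G ≃g VPT.GH H) := by
  constructor
  · rintro ⟨hn, hmin⟩
    obtain ⟨U, hU, H, hH, ⟨φ⟩⟩ := hG.exists_GH_embedding hh hn
    refine ⟨U, hU, H, hH, ⟨(RelIso.ofSurjective φ fun v => ?_).symm⟩⟩
    -- A vertex `v` missed by `φ` would place `G_H` inside `G - v`, which is in the class.
    by_contra hv
    refine hH.not_inClass_GH hh ((hmin v).comap ⟨⟨fun a => ⟨φ a, fun e => hv ⟨a, e⟩⟩, ?_⟩, ?_⟩)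
    · exact fun a b hab => φ.injective (congrArg Subtype.val hab)
    · exact φ.map_adj_iff
  · rintro ⟨U, hU, H, hH, ⟨φ⟩⟩
    refine ⟨fun hc => hH.not_inClass_GH hh (hc.comap φ.symm.toEmbedding), fun v => ?_⟩
    refine (hH.inClass_GH_induce hh (φ v)).comap
      ⟨⟨fun a => ⟨φ a.1, fun e => a.2 (φ.injective e)⟩, ?_⟩, ?_⟩
    · exact fun a b hab => Subtype.ext (φ.injective (congrArg Subtype.val hab))
    · exact φ.map_adj_iff
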